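/- Let $(x_k,y_k)_{k\ge 0}$ be a hidden Markov model with hidden states in $\{1,\dots,X\}$, observations in $\{1,\dots,Y\}$, row-stochastic transition matrix $[P]_{ij}=\Pr\{x_{k+1}=j\mid x_k=i\}$, row-stochastic observation matrix $[B]_{ij}=\Pr\{y_k=j\mid x_k=i\}$ and an arbitrary initial distribution $\pi_0$ of $x_0$. That is, for all $n$ and all $a_0,\dots,a_n$, $b_0,\dots,b_n$, $$\Pr\{x_k=a_k,\ y_k=b_k,\ 0\le k\le n\}=[\pi_0]_{a_0}[B]_{a_0b_0}\prod_{k=0}^{n-1}[P]_{a_ka_{k+1}}[B]_{a_{k+1}b_{k+1}}.$$ Assume that all entries of $P$ and of $B$ are strictly positive and that $B$ (an $X\times Y$ matrix) has full row rank $X$. Let $\pi_\infty$ be the stationary distribution of $P$ (the probability vector with $\pi_\infty=P^T\pi_\infty$), and let $\underline{\Pi}\subset\mathbb{R}^X$ be a polyhedron with $\pi_\infty\in\underline{\Pi}$ such that every $v\in\underline{\Pi}$ has strictly positive components. For $N\ge 1$ let $$[\hat M_\infty^{(N)}]_{ij}=\frac1N\sum_{k=0}^{N-1}\mathbf{1}\{y_k=i,\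 y_{k+1}=j\}$$ be the empirical second-order moments. For a matrix $M\in\mathbb{R}^{Y\times Y}$ consider the convex problem, with $\mathbb{1}$ the all-ones vector and $\|\cdot\|_F$ the Frobenius norm, $$\min_{A\in\mathbb{R}^{X\times X}}\ \|M-B^TAB\|_F^2\quad\text{subject to}\quad A\ge 0\ \text{(entrywise)},\quad \mathbb{1}^TA\mathbb{1}=1,\quad A\mathbb{1}\in\underline{\Pi},\quad A\mathbb{1}=A^T\mathbb{1}.$$ Then this problem has exactly one solution for every $M\in\mathbb{R}^{Y\times Y}$. Moreover, if $\hat A_N$ denotes the solution for $M=\hat M_\infty^{(N)}$, then with probability one, as $N\to\infty$, the estimates $$\hat\pi_\infty^{(N)}=\hat A_N\mathbb{1}\qquad\text{and}\qquad \hat P^{(N)}=\operatorname{diag}(\hat A_N\mathbb{1})^{-1}\hat A_N$$ converge to the true values $\pi_\infty$ and $P$, respectively. -/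

import Mathlib

open MeasureTheory Filter Topology
open scoped Matrix

/-- `x` (hidden states) and `y` (observations) form, under `μ`, a hidden Markov model with
initial distribution `p₀`, transition matrix `P` and observation matrix `B`: the joint law of
`(x₀, y₀, …, xₙ, yₙ)` has the product form
`p₀(a₀) B(a₀, b₀) ∏_{k < n} P(a_k, a_{k+1}) B(a_{k+1}, b_{k+1})`. -/
structure IsHMM {Ω : Type*} [MeasurableSpace Ω] (μ : Measure Ω) {X Y : ℕ}
    (p₀ : Fin X → ℝ) (P : Matrix (Fin X) (Fin X) ℝ) (B : Matrix (Fin X) (Fin Y) ℝ)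
    (x : ℕ → Ω → Fin X) (y : ℕ → Ω → Fin Y) : Prop where
  measurable_state : ∀ k, Measurable (x k)
  measurable_obs : ∀ k, Measurable (y k)
  joint_law : ∀ (n : ℕ) (a : ℕ → Fin X) (b : ℕ → Fin Y),
    μ {ω | ∀ k ≤ n, x k ω = a k ∧ y k ω = b k} =
      ENNReal.ofReal (p₀ (a 0) * B (a 0) (b 0) *
        ∏ k ∈ Finset.range n, (P (a k) (a (k + 1)) * B (a (k + 1)) (b (k + 1))))

/-- `p` is a stationary distribution of the transition matrix `P`. -/
def IsStationaryDistribution {X : ℕ} (P : Matrix (Fin X) (Fin X) ℝ) (p : Fin X → ℝ) : Prop :=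
  p ∈ stdSimplex ℝ (Fin X) ∧ p = Pᵀ *ᵥ p

/-- A polyhedron: the solution set of finitely many non-strict linear inequalities. -/
def IsPolyhedron {X : ℕ} (K : Set (Fin X → ℝ)) : Prop :=
  ∃ (m : ℕ) (G : Matrix (Fin m) (Fin X) ℝ) (g : Fin m → ℝ), K = {v | ∀ i, (G *ᵥ v) i ≤ g i}

/-- The empirical second-order moments: the fraction of the `N` consecutive pairs
`(y_k, y_{k+1})`, `k < N`, that are equal to `(i, j)`. -/
noncomputable def empiricalMoments {Y : ℕ} (y : ℕ → Fin Y) (N : ℕ) :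
    Matrix (Fin Y) (Fin Y) ℝ :=
  Matrix.of fun i j =>
    (1 / (N : ℝ)) * ∑ k ∈ Finset.range N, if y k = i ∧ y (k + 1) = j then (1 : ℝ) else 0

/-- The feasible set of the convex moment matching problem. -/
def momentFeasibleSet {X : ℕ} (K : Set (Fin X → ℝ)) : Set (Matrix (Fin X) (Fin X) ℝ) :=
  {A | (∀ i j, 0 ≤ A i j) ∧ 1 ⬝ᵥ (A *ᵥ 1) = 1 ∧ A *ᵥ 1 ∈ K ∧ A *ᵥ 1 = Aᵀ *ᵥ 1}

section Frobenius

open scoped Matrix.Norms.Frobenius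

/-- The cost `‖M - Bᵀ A B‖_F²` (squared Frobenius norm). -/
noncomputable def momentCost {X Y : ℕ} (B : Matrix (Fin X) (Fin Y) ℝ)
    (M : Matrix (Fin Y) (Fin Y) ℝ) (A : Matrix (Fin X) (Fin X) ℝ) : ℝ :=
  ‖M - Bᵀ * A * B‖ ^ 2

theorem momentCost_eq_sum {X Y : ℕ} (B : Matrix (Fin X) (Fin Y) ℝ)
    (M : Matrix (Fin Y) (Fin Y) ℝ) (A : Matrix (Fin X) (Fin X) ℝ) :
    momentCost B M A = ∑ i, ∑ j, ((M - Bᵀ * A * B) i j) ^ 2 := by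
  unfold momentCost
  rw [Matrix.frobenius_norm_def, ← Real.sqrt_eq_rpow, Real.sq_sqrt]
  · simp
  · positivity

end Frobenius

/-- `A` solves the convex moment matching problem with moment matrix `M`. -/
def IsMomentSolution {X Y : ℕ} (B : Matrix (Fin X) (Fin Y) ℝ) (K : Set (Fin X → ℝ))
    (M : Matrix (Fin Y) (Fin Y) ℝ) (A : Matrix (Fin X) (Fin X) ℝ) : Prop :=
  A ∈ momentFeasibleSet K ∧ IsMinOn (momentCost B M) (momentFeasibleSet K) A

/-- The stationary distribution recovered from `A`, namely `A 1`. -/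
def recoverStationary {X : ℕ} (A : Matrix (Fin X) (Fin X) ℝ) : Fin X → ℝ :=
  A *ᵥ 1

/-- The transition matrix recovered from `A`, namely `diag(A 1)⁻¹ A`. -/
noncomputable def recoverTransition {X : ℕ} (A : Matrix (Fin X) (Fin X) ℝ) :
    Matrix (Fin X) (Fin X) ℝ :=
  (Matrix.diagonal (A *ᵥ 1))⁻¹ * A

/-! Since `B` has a right inverse `C`, the map `A ↦ Bᵀ * A * B` is injective, with left inverse `L ↦
Cᵀ * L * C`. The feasible set is convex and compact, and it contains `diagonal pinf * P`, the
stationary joint law of two consecutive states. Hence a minimiser exists, and strict convexity of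
the squared norm makes it unique.

Once the empirical moments converge to `Bᵀ * (diagonal pinf * P) * B`, the cost of the true matrix
tends to zero; by minimality so does the cost of the estimates, and the left inverse carries this
back to convergence of the estimates (`tendsto_isMomentSolution`). Positivity on `K` makes the row
normalisation continuous.

The moments converge because the pairs `(x k, y k)` form a Markov chain with a strictly positive
kernel. Its innovations (indicator of an arrival minus its conditional probability) give bounded
orthogonal variables, which average to zero almost surely (`ae_tendsto_sum_div_of_orthogonal`).
Occupation frequencies are then asymptotically invariant, and a Doeblin bound
(`mul_sum_abs_le_of_sum_eq_zero`) drives them to the stationary law, whatever the initial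
distribution. -/

/-! ### Strong law for bounded orthogonal variables -/

/-- The second moments of sums of uniformly bounded orthogonal variables grow at most linearly. -/
theorem integral_sq_sum_le_of_orthogonal {Ω : Type*} [MeasurableSpace Ω] (μ : Measure Ω)
    [IsProbabilityMeasure μ] (d : ℕ → Ω → ℝ) (hd : ∀ k, Measurable (d k))
    (hb : ∀ k ω, |d k ω| ≤ 1) (ho : ∀ k l, k < l → ∫ ω, d k ω * d l ω ∂μ = 0) (N : ℕ) :
    ∫ ω, (∑ k ∈ Finset.range N, d k ω) ^ 2 ∂μ ≤ N := by
  have hint : ∀ k l, Integrable (fun ω => d k ω * d l ω) μ := fun k l =>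
    Integrable.of_bound ((hd k).mul (hd l)).aestronglyMeasurable 1 <| ae_of_all _ fun ω => by
      rw [Real.norm_eq_abs, abs_mul]
      exact mul_le_one₀ (hb k ω) (abs_nonneg _) (hb l ω)
  have hexp : ∀ ω, (∑ k ∈ Finset.range N, d k ω) ^ 2 =
      ∑ k ∈ Finset.range N, ∑ l ∈ Finset.range N, d k ω * d l ω := fun ω => by
    rw [sq, Finset.sum_mul_sum]
  simp_rw [hexp]
  rw [integral_finsetSum _ fun k _ => integrable_finsetSum _ fun l _ => hint k l]
  calc ∑ k ∈ Finset.range N, ∫ ω, ∑ l ∈ Finset.range N, d k ω * d l ω ∂μ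
      ≤ ∑ k ∈ Finset.range N, (1 : ℝ) := ?_
    _ = N := by simp
  refine Finset.sum_le_sum fun k hk => ?_
  -- By orthogonality only the diagonal term `l = k` survives.
  rw [integral_finsetSum _ fun l _ => hint k l, Finset.sum_eq_single_of_mem k hk]
  · calc ∫ ω, d k ω * d k ω ∂μ ≤ ∫ _, (1 : ℝ) ∂μ := by
          refine integral_mono (hint k k) (integrable_const _) fun ω => ?_
          have := hb k ω
          rw [← abs_mul_abs_self]
          exact mul_le_one₀ this (abs_nonneg _) this
      _ = 1 := by simp
  · intro l _ hl
    rcases lt_or_gt_of_ne hl with h | h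
    · simpa only [mul_comm] using ho l k h
    · exact ho k l h

/-- If the partial sums of a bounded sequence are negligible along the squares, then they are
negligible along all integers. -/
theorem tendsto_sum_div_of_tendsto_sq {u : ℕ → ℝ} (hu : ∀ k, |u k| ≤ 1)
    (h : Tendsto (fun n : ℕ => (∑ k ∈ Finset.range (n ^ 2), u k) / ((n ^ 2 : ℕ) : ℝ)) atTop (𝓝 0)) :
    Tendsto (fun N : ℕ => (∑ k ∈ Finset.range N, u k) / (N : ℝ)) atTop (𝓝 0) := by
  have hs : Tendsto Nat.sqrt atTop atTop := by
    refine tendsto_atTop_atTop.2 fun b => ⟨b ^ 2, fun a ha => Nat.le_sqrt'.2 ha⟩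
  -- With `n = ⌊√N⌋`, at most `2 * n` terms lie beyond index `n ^ 2`; divided by `n ^ 2 ≤ N` they
  -- contribute at most `2 / n`.
  have hlim : Tendsto (fun n : ℕ => |(∑ k ∈ Finset.range (n ^ 2), u k) / ((n ^ 2 : ℕ) : ℝ)| +
      2 / (n : ℝ)) atTop (𝓝 0) := by
    simpa using h.abs.add (tendsto_const_div_atTop_nhds_zero_nat 2)
  refine squeeze_zero_norm' ?_ (hlim.comp hs)
  filter_upwards [eventually_ge_atTop 1] with N hN
  set n := Nat.sqrt N with hn
  have hn1 : 1 ≤ n := Nat.le_sqrt'.2 (by simpa using hN)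
  have hle : n ^ 2 ≤ N := Nat.sqrt_le' N
  have hle2 : N ≤ n ^ 2 + 2 * n := by
    have := Nat.sqrt_le_add N
    rw [← hn] at this
    nlinarith
  have hn0 : (0 : ℝ) < n := by exact_mod_cast hn1
  have hN0 : (0 : ℝ) < N := by exact_mod_cast hN
  have hleR : (n : ℝ) ^ 2 ≤ N := by exact_mod_cast hle
  have hsum : |∑ k ∈ Finset.range N, u k| ≤ |∑ k ∈ Finset.range (n ^ 2), u k| + 2 * n := by
    rw [← Finset.sum_range_add_sum_Ico _ hle]
    refine (abs_add_le _ _).trans (add_le_add le_rfl ?_)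
    calc |∑ k ∈ Finset.Ico (n ^ 2) N, u k| ≤ ∑ k ∈ Finset.Ico (n ^ 2) N, |u k| :=
          Finset.abs_sum_le_sum_abs _ _
      _ ≤ ∑ k ∈ Finset.Ico (n ^ 2) N, (1 : ℝ) := Finset.sum_le_sum fun k _ => hu k
      _ = ((N - n ^ 2 : ℕ) : ℝ) := by simp
      _ ≤ 2 * n := by exact_mod_cast (by omega : N - n ^ 2 ≤ 2 * n)
  simp only [Function.comp, Real.norm_eq_abs, abs_div, Nat.cast_pow, abs_pow, Nat.abs_cast]
  calc |∑ k ∈ Finset.range N, u k| / (N : ℝ)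
      ≤ (|∑ k ∈ Finset.range (n ^ 2), u k| + 2 * n) / (n : ℝ) ^ 2 := by gcongr
    _ = |∑ k ∈ Finset.range (n ^ 2), u k| / (n : ℝ) ^ 2 + 2 / n := by field_simp

/-- Strong law of large numbers for uniformly bounded orthogonal random variables. -/
theorem ae_tendsto_sum_div_of_orthogonal {Ω : Type*} [MeasurableSpace Ω] (μ : Measure Ω)
    [IsProbabilityMeasure μ] (d : ℕ → Ω → ℝ) (hd : ∀ k, Measurable (d k))
    (hb : ∀ k ω, |d k ω| ≤ 1) (ho : ∀ k l, k < l → ∫ ω, d k ω * d l ω ∂μ = 0) :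
    ∀ᵐ ω ∂μ, Tendsto (fun N : ℕ => (∑ k ∈ Finset.range N, d k ω) / (N : ℝ)) atTop (𝓝 0) := by
  set S : ℕ → Ω → ℝ := fun n ω => (∑ k ∈ Finset.range (n ^ 2), d k ω) / ((n ^ 2 : ℕ) : ℝ) with hS
  have hSm : ∀ n, Measurable (S n) := fun n =>
    (Finset.measurable_fun_sum _ fun k _ => hd k).div_const _
  have hSb : ∀ n ω, |∑ k ∈ Finset.range (n ^ 2), d k ω| ≤ ((n ^ 2 : ℕ) : ℝ) := fun n ω => by
    refine (Finset.abs_sum_le_sum_abs _ _).trans ?_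
    refine (Finset.sum_le_sum fun k _ => hb k ω).trans ?_
    simp
  have hSint : ∀ n, Integrable (fun ω => S n ω ^ 2) μ := fun n =>
    Integrable.of_bound ((hSm n).pow_const 2).aestronglyMeasurable 1 <| ae_of_all _ fun ω => by
      rw [Real.norm_eq_abs, abs_pow]
      refine pow_le_one₀ (abs_nonneg _) ?_
      rw [hS]
      simp only [abs_div, Nat.abs_cast]
      exact div_le_one_of_le₀ (hSb n ω) (Nat.cast_nonneg _)
  have hSle : ∀ n : ℕ, ∫ ω, S n ω ^ 2 ∂μ ≤ 1 / (n : ℝ) ^ 2 := fun n => by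
    simp only [hS, div_pow]
    rw [integral_div]
    refine (div_le_div_of_nonneg_right (integral_sq_sum_le_of_orthogonal μ d hd hb ho (n ^ 2))
      (by positivity)).trans (le_of_eq ?_)
    push_cast
    rcases eq_or_ne (n : ℝ) 0 with h | h
    · simp [h]
    · field_simp
  -- Along the squares the second moments are summable, so `∑ S n ^ 2` is almost surely finite and
  -- its terms tend to zero.
  have hfin : ∫⁻ ω, ∑' n, ENNReal.ofReal (S n ω ^ 2) ∂μ ≠ ⊤ := by
    rw [lintegral_tsum fun n => ((hSm n).pow_const 2).ennreal_ofReal.aemeasurable]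
    have hle : ∀ n : ℕ, ∫⁻ ω, ENNReal.ofReal (S n ω ^ 2) ∂μ ≤ ENNReal.ofReal (1 / (n : ℝ) ^ 2) :=
      fun n => by
        rw [← ofReal_integral_eq_lintegral_ofReal (hSint n) (ae_of_all _ fun ω => sq_nonneg _)]
        exact ENNReal.ofReal_le_ofReal (hSle n)
    refine ne_top_of_le_ne_top ?_ (ENNReal.tsum_le_tsum hle)
    exact (Real.summable_one_div_nat_pow.2 one_lt_two).tsum_ofReal_ne_top
  filter_upwards [ae_lt_top (Measurable.tsum fun n =>
    ((hSm n).pow_const 2).ennreal_ofReal) hfin] with ω hω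
  refine tendsto_sum_div_of_tendsto_sq (fun k => hb k ω) ?_
  have h0 := ENNReal.tendsto_atTop_zero_of_tsum_ne_top hω.ne
  have h1 : Tendsto (fun n => S n ω ^ 2) atTop (𝓝 0) := by
    have := (ENNReal.tendsto_toReal ENNReal.zero_ne_top).comp h0
    simpa [Function.comp_def, ENNReal.toReal_ofReal (sq_nonneg _)] using this
  have h2 := h1.sqrt
  simp only [Real.sqrt_sq_eq_abs, Real.sqrt_zero] at h2
  exact (tendsto_zero_iff_abs_tendsto_zero _).2 h2

/-! ### Ergodic theorem for strictly positive finite Markov chains -/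

/-- Quantitative uniqueness of the invariant distribution of a strictly positive kernel: a vector
of total mass zero is controlled by its defect of invariance. -/
theorem mul_sum_abs_le_of_sum_eq_zero {S : Type*} [Fintype S] {Q : S → S → ℝ} {δ : ℝ}
    (hδ : ∀ s t, δ ≤ Q s t) (hQ : ∀ s, ∑ t, Q s t = 1) {v : S → ℝ} (hv : ∑ s, v s = 0) :
    δ * Fintype.card S * ∑ s, |v s| ≤ ∑ t, |v t - ∑ s, v s * Q s t| := by
  have hbound : ∀ t, |v t| ≤ |v t - ∑ s, v s * Q s t| + ∑ s, |v s| * (Q s t - δ) := fun t => by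
    -- Subtracting the constant `δ` from the kernel is free because `v` has total mass zero.
    have hrepr : v t = (v t - ∑ s, v s * Q s t) + ∑ s, v s * (Q s t - δ) := by
      simp only [mul_sub, Finset.sum_sub_distrib, ← Finset.sum_mul, hv]
      ring
    calc |v t| = |(v t - ∑ s, v s * Q s t) + ∑ s, v s * (Q s t - δ)| := by rw [← hrepr]
      _ ≤ |v t - ∑ s, v s * Q s t| + |∑ s, v s * (Q s t - δ)| := abs_add_le _ _
      _ ≤ _ := by
        refine add_le_add le_rfl ((Finset.abs_sum_le_sum_abs _ _).trans (le_of_eq ?_))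
        refine Finset.sum_congr rfl fun s _ => ?_
        rw [abs_mul, abs_of_nonneg (sub_nonneg.2 (hδ s t))]
  -- The rows of `Q - δ` sum to `1 - δ * card S`; this deficit is the contraction factor gained.
  have hsum := Finset.sum_le_sum fun t (_ : t ∈ Finset.univ) => hbound t
  rw [Finset.sum_add_distrib, Finset.sum_comm (f := fun t s => |v s| * (Q s t - δ))] at hsum
  simp only [← Finset.mul_sum, Finset.sum_sub_distrib, hQ, Finset.sum_const, Finset.card_univ,
    nsmul_eq_mul, ← Finset.sum_mul] at hsum
  linarith

/-- For a Markov chain, the innovation of a transition is orthogonal to every function of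
the past. -/
theorem integral_mul_innovation_eq_zero {Ω : Type*} [MeasurableSpace Ω] (μ : Measure Ω)
    [IsProbabilityMeasure μ] {S : Type*} [Fintype S] [DecidableEq S] [MeasurableSpace S]
    [MeasurableSingletonClass S] {Q : S → S → ℝ} {w : ℕ → Ω → S} (hw : ∀ k, Measurable (w k))
    (hlaw : ∀ (n : ℕ) (a : ℕ → S) (t : S), μ.real {ω | (∀ k ≤ n, w k ω = a k) ∧ w (n + 1) ω = t} =
      Q (a n) t * μ.real {ω | ∀ k ≤ n, w k ω = a k})
    (n : ℕ) (t : S) (g : (ℕ → S) → ℝ) (hg : ∀ u v : ℕ → S, (∀ k ≤ n, u k = v k) → g u = g v) :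
    ∫ ω, g (fun k => w k ω) * ((if w (n + 1) ω = t then 1 else 0) - Q (w n ω) t) ∂μ = 0 := by
  -- A finite path is extended by freezing it after time `n`; the values beyond `n` are irrelevant
  -- to `g` by `hg`.
  set e : (Fin (n + 1) → S) → ℕ → S := fun a k => a ⟨min k n, by omega⟩ with he
  set E : (Fin (n + 1) → S) → Set Ω := fun a => {ω | ∀ k ≤ n, w k ω = e a k} with hE
  set E' : (Fin (n + 1) → S) → Set Ω := fun a => {ω | (∀ k ≤ n, w k ω = e a k) ∧ w (n + 1) ω = t}
    with hE'
  have hEm : ∀ a, MeasurableSet (E a) := fun a => by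
    have : E a = ⋂ k ∈ Set.Iic n, w k ⁻¹' {e a k} := by ext ω; simp [hE]
    rw [this]
    exact MeasurableSet.biInter (Set.to_countable _) fun k _ => hw k (measurableSet_singleton _)
  have hEm' : ∀ a, MeasurableSet (E' a) := fun a =>
    (hEm a).inter (hw (n + 1) (measurableSet_singleton t))
  -- The cylinders `E a` partition `Ω` into finitely many pieces, on each of which `g` is constant.
  have hdecomp : ∀ ω, g (fun k => w k ω) * ((if w (n + 1) ω = t then 1 else 0) - Q (w n ω) t) =
      ∑ a, g (e a) * ((E' a).indicator 1 ω - Q (e a n) t * (E a).indicator 1 ω) := fun ω => by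
    have hmem : ω ∈ E fun i => w i ω := fun k hk => by simp [he, min_eq_left hk]
    rw [Finset.sum_eq_single fun i : Fin (n + 1) => w i ω]
    · rw [Set.indicator_of_mem hmem, hg (e fun i : Fin (n + 1) => w i ω) (fun k => w k ω)
        fun k hk => (hmem k hk).symm, ← hmem n le_rfl]
      by_cases h : w (n + 1) ω = t
      · rw [Set.indicator_of_mem (show ω ∈ E' fun i => w i ω from ⟨hmem, h⟩)]
        simp [h]
      · rw [Set.indicator_of_notMem (fun h' => h h'.2)]
        simp [h]
    · intro a _ ha
      have hn : ω ∉ E a := fun h => ha <| funext fun i => by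
        have := h i (Nat.lt_succ_iff.1 i.2)
        simpa [he, min_eq_left (Nat.lt_succ_iff.1 i.2)] using this.symm
      rw [Set.indicator_of_notMem hn, Set.indicator_of_notMem (fun h' => hn h'.1)]
      simp
    · simp
  have hi : ∀ A : Set Ω, MeasurableSet A → Integrable (fun ω => A.indicator (1 : Ω → ℝ) ω) μ :=
    fun A hA => (integrable_const (1 : ℝ)).indicator hA
  have hterm : ∀ a, Integrable (fun ω => g (e a) * ((E' a).indicator (1 : Ω → ℝ) ω -
      Q (e a n) t * (E a).indicator (1 : Ω → ℝ) ω)) μ := fun a =>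
    ((hi _ (hEm' a)).sub ((hi _ (hEm a)).const_mul _)).const_mul _
  simp_rw [hdecomp]
  rw [integral_finsetSum _ fun a _ => hterm a]
  refine Finset.sum_eq_zero fun a _ => ?_
  rw [integral_const_mul, integral_sub (hi _ (hEm' a)) ((hi _ (hEm a)).const_mul _),
    integral_const_mul, integral_indicator_one (hEm' a), integral_indicator_one (hEm a),
    hlaw n (e a) t, sub_self, mul_zero]

/-- Ergodic theorem for the occupation frequencies of a strictly positive finite Markov chain,
along a trajectory whose innovations average out. -/
theorem tendsto_occupation_of_innovation {S : Type*} [Fintype S] [DecidableEq S]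
    {Q : S → S → ℝ} (hQ0 : ∀ s t, 0 < Q s t) (hQ : ∀ s, ∑ t, Q s t = 1) {q : S → ℝ} (hq : ∑ s, q s = 1)
    (hqQ : ∀ t, ∑ s, q s * Q s t = q t) {z : ℕ → S}
    (hz : ∀ s t, Tendsto (fun N : ℕ => (∑ k ∈ Finset.range N, (if z k = s then (1 : ℝ) else 0) *
      ((if z (k + 1) = t then 1 else 0) - Q (z k) t)) / (N : ℝ)) atTop (𝓝 0)) (s : S) :
    Tendsto (fun N : ℕ => (∑ k ∈ Finset.range N, if z k = s then (1 : ℝ) else 0) / (N : ℝ))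
      atTop (𝓝 (q s)) := by
  set c : ℕ → S → ℝ := fun N t => (∑ k ∈ Finset.range N, if z k = t then (1 : ℝ) else 0) / (N : ℝ)
    with hc
  obtain ⟨δ, hδ0, hδ⟩ : ∃ δ : ℝ, 0 < δ ∧ ∀ s t, δ ≤ Q s t := by
    obtain ⟨p, -, hp⟩ := Finset.exists_min_image (Finset.univ : Finset (S × S))
      (fun p => Q p.1 p.2) ⟨(z 0, z 0), Finset.mem_univ _⟩
    exact ⟨Q p.1 p.2, hQ0 _ _, fun s t => hp (s, t) (Finset.mem_univ _)⟩
  have hcard : (0 : ℝ) < Fintype.card S := by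
    have : Nonempty S := ⟨z 0⟩
    exact_mod_cast Fintype.card_pos
  have hcsum : ∀ N ≥ 1, ∑ s, c N s = 1 := fun N hN => by
    have hN0 : (N : ℝ) ≠ 0 := by positivity
    simp only [hc]
    rw [← Finset.sum_div, Finset.sum_comm]
    simp [hN0]
  have hdefect : ∀ t, Tendsto (fun N => c N t - ∑ s, c N s * Q s t) atTop (𝓝 0) := fun t => by
    have hT := tendsto_finsetSum Finset.univ fun s (_ : s ∈ Finset.univ) => hz s t
    -- Arrivals are counted at times `1, …, N` but `c N` counts times `0, …, N - 1`; this is the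
    -- boundary term of the shift.
    have hb : Tendsto (fun N : ℕ => ((if z 0 = t then (1 : ℝ) else 0) -
        (if z N = t then 1 else 0)) / (N : ℝ)) atTop (𝓝 0) := by
      refine squeeze_zero_norm (fun N => ?_) tendsto_one_div_atTop_nhds_zero_nat
      rw [norm_div, Real.norm_natCast]
      gcongr
      split_ifs <;> simp
    have h := hT.add hb
    simp only [Finset.sum_const_zero, add_zero] at h
    refine h.congr fun N => ?_
    simp only [hc, div_mul_eq_mul_div]
    rw [← Finset.sum_div, ← Finset.sum_div, ← add_div, ← sub_div]
    congr 1
    have h1 : ∑ s, ∑ k ∈ Finset.range N, (if z k = s then (1 : ℝ) else 0) *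
        ((if z (k + 1) = t then 1 else 0) - Q (z k) t) =
        ∑ k ∈ Finset.range N, ((if z (k + 1) = t then 1 else 0) - Q (z k) t) := by
      rw [Finset.sum_comm]
      refine Finset.sum_congr rfl fun k _ => ?_
      simp
    have h2 : ∑ s, (∑ k ∈ Finset.range N, if z k = s then (1 : ℝ) else 0) * Q s t =
        ∑ k ∈ Finset.range N, Q (z k) t := by
      simp only [Finset.sum_mul]
      rw [Finset.sum_comm]
      refine Finset.sum_congr rfl fun k _ => ?_
      simp
    have h3 := Finset.sum_range_sub (fun k => if z k = t then (1 : ℝ) else 0) N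
    rw [Finset.sum_sub_distrib] at h3
    rw [h1, h2, Finset.sum_sub_distrib]
    linarith
  have hE : Tendsto (fun N => (∑ t, |c N t - ∑ s, c N s * Q s t|) / (δ * Fintype.card S))
      atTop (𝓝 0) := by
    have h := (tendsto_finsetSum Finset.univ fun t (_ : t ∈ Finset.univ) =>
      (hdefect t).abs).div_const (δ * Fintype.card S)
    simpa using h
  refine tendsto_iff_norm_sub_tendsto_zero.2 (squeeze_zero' (Eventually.of_forall fun N =>
    norm_nonneg _) ?_ hE)
  filter_upwards [eventually_ge_atTop 1] with N hN
  have hle := mul_sum_abs_le_of_sum_eq_zero hδ hQ (v := fun s => c N s - q s) (by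
    rw [Finset.sum_sub_distrib, hcsum N hN, hq, sub_self])
  -- As `q` is invariant, `c N - q` has the same defect as `c N`.
  have hdef : ∀ t, (c N t - q t) - ∑ s, (c N s - q s) * Q s t = c N t - ∑ s, c N s * Q s t :=
    fun t => by
      simp only [sub_mul, Finset.sum_sub_distrib, hqQ]
      ring
  simp only [hdef] at hle
  rw [le_div_iff₀ (by positivity), mul_comm]
  refine le_trans ?_ hle
  gcongr
  rw [Real.norm_eq_abs]
  exact Finset.single_le_sum (f := fun s => |c N s - q s|) (fun s _ => abs_nonneg _)
    (Finset.mem_univ s)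

section MarkovChain

variable {Ω : Type*} [MeasurableSpace Ω] (μ : Measure Ω) [IsProbabilityMeasure μ]
  {S : Type*} [Fintype S] [DecidableEq S] [MeasurableSpace S] [MeasurableSingletonClass S]
  {Q : S → S → ℝ} {w : ℕ → Ω → S}

/-- The number of transitions from `s` to `t` is asymptotically its predictable part. -/
theorem ae_tendsto_innovation_average (hQ0 : ∀ s t, 0 ≤ Q s t) (hQ : ∀ s, ∑ t, Q s t = 1)
    (hw : ∀ k, Measurable (w k))
    (hlaw : ∀ (n : ℕ) (a : ℕ → S) (t : S), μ.real {ω | (∀ k ≤ n, w k ω = a k) ∧ w (n + 1) ω = t} =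
      Q (a n) t * μ.real {ω | ∀ k ≤ n, w k ω = a k}) (s t : S) :
    ∀ᵐ ω ∂μ, Tendsto (fun N : ℕ => (∑ k ∈ Finset.range N, (if w k ω = s then (1 : ℝ) else 0) *
      ((if w (k + 1) ω = t then 1 else 0) - Q (w k ω) t)) / (N : ℝ)) atTop (𝓝 0) := by
  have hQ1 : ∀ s t, Q s t ≤ 1 := fun s t => by
    rw [← hQ s]
    exact Finset.single_le_sum (fun t _ => hQ0 s t) (Finset.mem_univ t)
  refine ae_tendsto_sum_div_of_orthogonal μ (fun k ω => (if w k ω = s then (1 : ℝ) else 0) *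
      ((if w (k + 1) ω = t then 1 else 0) - Q (w k ω) t)) (fun k => ?_) (fun k ω => ?_) ?_
  · have hi : ∀ k s, Measurable fun ω => if w k ω = s then (1 : ℝ) else 0 := fun k s =>
      Measurable.ite (hw k (measurableSet_singleton s)) measurable_const measurable_const
    exact (hi k s).mul ((hi (k + 1) t).sub ((measurable_of_finite fun s => Q s t).comp (hw k)))
  · have h0 := hQ0 (w k ω) t
    have h1 := hQ1 (w k ω) t
    rw [abs_le]
    split_ifs <;> constructor <;> linarith
  · intro k l hkl
    -- Since `k + 1 ≤ l`, the earlier variable, together with the indicator at time `l`, is a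
    -- function of the path up to `l`.
    have := integral_mul_innovation_eq_zero μ hw hlaw l t
      (fun u => ((if u k = s then (1 : ℝ) else 0) *
        ((if u (k + 1) = t then 1 else 0) - Q (u k) t)) * (if u l = s then 1 else 0))
      (fun u v huv => by simp only [huv k hkl.le, huv (k + 1) hkl, huv l le_rfl])
    exact (integral_congr_ae (ae_of_all _ fun ω => by ring)).trans this

/-- Ergodic theorem for the transition frequencies of a strictly positive finite Markov chain. -/
theorem ae_tendsto_transition_average (hQ0 : ∀ s t, 0 < Q s t) (hQ : ∀ s, ∑ t, Q s t = 1)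
    {q : S → ℝ} (hq : ∑ s, q s = 1) (hqQ : ∀ t, ∑ s, q s * Q s t = q t)
    (hw : ∀ k, Measurable (w k))
    (hlaw : ∀ (n : ℕ) (a : ℕ → S) (t : S), μ.real {ω | (∀ k ≤ n, w k ω = a k) ∧ w (n + 1) ω = t} =
      Q (a n) t * μ.real {ω | ∀ k ≤ n, w k ω = a k}) :
    ∀ᵐ ω ∂μ, ∀ s t, Tendsto (fun N : ℕ => (∑ k ∈ Finset.range N,
      if w k ω = s ∧ w (k + 1) ω = t then (1 : ℝ) else 0) / (N : ℝ)) atTop (𝓝 (q s * Q s t)) := by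
  have hinn := ae_all_iff.2 fun s => ae_all_iff.2 fun t =>
    ae_tendsto_innovation_average μ (fun s t => (hQ0 s t).le) hQ hw hlaw s t
  filter_upwards [hinn] with ω hω s t
  have hocc := tendsto_occupation_of_innovation hQ0 hQ hq hqQ (z := fun k => w k ω) hω s
  -- A transition indicator is its innovation plus `Q s t` times the indicator of being at `s`.
  have h := (hω s t).add (hocc.mul_const (Q s t))
  rw [zero_add] at h
  refine h.congr fun N => ?_
  rw [div_mul_eq_mul_div, ← add_div, Finset.sum_mul, ← Finset.sum_add_distrib]
  congr 1
  refine Finset.sum_congr rfl fun k _ => ?_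
  by_cases h1 : w k ω = s
  · simp [h1]
  · simp [h1]

end MarkovChain

/-! ### Existence and uniqueness for the moment matching problem -/

theorem Matrix.exists_right_inverse_of_rank_eq {X Y : ℕ} {B : Matrix (Fin X) (Fin Y) ℝ}
    (hB : B.rank = X) : ∃ C : Matrix (Fin Y) (Fin X) ℝ, B * C = 1 := by
  refine Matrix.mulVec_surjective_iff_exists_right_inverse.1 ?_
  have : LinearMap.range B.mulVecLin = ⊤ := Submodule.eq_top_of_finrank_eq (by
    rw [← Matrix.rank, hB]; simp)
  exact LinearMap.range_eq_top.1 this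

theorem eq_transpose_mul_mul_of_right_inverse {X Y : ℕ} {B : Matrix (Fin X) (Fin Y) ℝ}
    {C : Matrix (Fin Y) (Fin X) ℝ} (hC : B * C = 1) (A : Matrix (Fin X) (Fin X) ℝ) :
    Cᵀ * (Bᵀ * A * B) * C = A := by
  have hC' : Cᵀ * Bᵀ = 1 := by rw [← Matrix.transpose_mul, hC, Matrix.transpose_one]
  calc Cᵀ * (Bᵀ * A * B) * C = (Cᵀ * Bᵀ) * A * (B * C) := by simp only [Matrix.mul_assoc]
    _ = A := by rw [hC, hC', Matrix.one_mul, Matrix.mul_one]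

theorem IsPolyhedron.isClosed {X : ℕ} {K : Set (Fin X → ℝ)} (hK : IsPolyhedron K) :
    IsClosed K := by
  obtain ⟨m, G, g, rfl⟩ := hK
  simp only [Set.ofPred_forall]
  refine isClosed_iInter fun i => isClosed_le ?_ continuous_const
  exact (continuous_apply i).comp (continuous_const.matrix_mulVec continuous_id)

theorem IsPolyhedron.convex {X : ℕ} {K : Set (Fin X → ℝ)} (hK : IsPolyhedron K) :
    Convex ℝ K := by
  obtain ⟨m, G, g, rfl⟩ := hK
  intro u hu v hv a b ha hb hab i
  have h1 := mul_le_mul_of_nonneg_left (hu i) ha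
  have h2 := mul_le_mul_of_nonneg_left (hv i) hb
  simp only [Matrix.mulVec_add, Matrix.mulVec_smul, Pi.add_apply, Pi.smul_apply, smul_eq_mul]
  calc _ ≤ a * g i + b * g i := add_le_add h1 h2
    _ = g i := by rw [← add_mul, hab, one_mul]

theorem convex_momentFeasibleSet {X : ℕ} {K : Set (Fin X → ℝ)} (hK : Convex ℝ K) :
    Convex ℝ (momentFeasibleSet K) := by
  rintro A ⟨hA0, hA1, hA2, hA3⟩ A' ⟨hA'0, hA'1, hA'2, hA'3⟩ a b ha hb hab
  refine ⟨fun i j => ?_, ?_, ?_, ?_⟩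
  · have := hA0 i j
    have := hA'0 i j
    simp only [Matrix.add_apply, Matrix.smul_apply, smul_eq_mul]
    positivity
  · rw [Matrix.add_mulVec, Matrix.smul_mulVec, Matrix.smul_mulVec, dotProduct_add,
      dotProduct_smul, dotProduct_smul, hA1, hA'1]
    simpa using hab
  · rw [Matrix.add_mulVec, Matrix.smul_mulVec, Matrix.smul_mulVec]
    exact hK hA2 hA'2 ha hb hab
  · rw [Matrix.transpose_add, Matrix.transpose_smul, Matrix.transpose_smul, Matrix.add_mulVec,
      Matrix.smul_mulVec, Matrix.smul_mulVec, Matrix.add_mulVec,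
      Matrix.smul_mulVec, Matrix.smul_mulVec, hA3, hA'3]

theorem isCompact_momentFeasibleSet {X : ℕ} {K : Set (Fin X → ℝ)} (hK : IsClosed K) :
    IsCompact (momentFeasibleSet K) := by
  have hrow : Continuous fun A : Matrix (Fin X) (Fin X) ℝ => A *ᵥ (1 : Fin X → ℝ) :=
    continuous_id.matrix_mulVec continuous_const
  have hcol : Continuous fun A : Matrix (Fin X) (Fin X) ℝ => Aᵀ *ᵥ (1 : Fin X → ℝ) :=
    continuous_id.matrix_transpose.matrix_mulVec continuous_const
  have hclosed : IsClosed (momentFeasibleSet K) := by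
    have hnn : IsClosed {A : Matrix (Fin X) (Fin X) ℝ | ∀ i j, 0 ≤ A i j} := by
      simp only [Set.ofPred_forall]
      exact isClosed_iInter fun i => isClosed_iInter fun j =>
        isClosed_le continuous_const (continuous_id.matrix_elem i j)
    refine hnn.inter (IsClosed.inter ?_ (IsClosed.inter ?_ ?_))
    · exact isClosed_eq (continuous_const.dotProduct hrow) continuous_const
    · exact hK.preimage hrow
    · exact isClosed_eq hrow hcol
  have hbox : IsCompact (Set.univ.pi fun _ : Fin X => Set.univ.pi fun _ : Fin X =>
      Set.Icc (0 : ℝ) 1) :=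
    isCompact_univ_pi fun _ => isCompact_univ_pi fun _ => isCompact_Icc
  -- Nonnegative entries with total sum one all lie in `[0, 1]`.
  refine hbox.of_isClosed_subset hclosed ?_
  rintro A ⟨hA0, hA1, -, -⟩ i - j -
  refine ⟨hA0 i j, ?_⟩
  have h1 : ∑ i, ∑ j, A i j = 1 := by
    simpa [dotProduct, Matrix.mulVec] using hA1
  rw [← h1]
  exact (Finset.single_le_sum (fun j _ => hA0 i j) (Finset.mem_univ j)).trans
    (Finset.single_le_sum (f := fun i => ∑ j, A i j)
      (fun i _ => Finset.sum_nonneg fun j _ => hA0 i j) (Finset.mem_univ i))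

theorem continuous_momentCost {X Y : ℕ} (B : Matrix (Fin X) (Fin Y) ℝ)
    (M : Matrix (Fin Y) (Fin Y) ℝ) : Continuous (momentCost B M) := by
  have h : momentCost B M = fun A => ∑ i, ∑ j, ((M - Bᵀ * A * B) i j) ^ 2 :=
    funext fun A => momentCost_eq_sum B M A
  have hm : Continuous fun A : Matrix (Fin X) (Fin X) ℝ => M - Bᵀ * A * B :=
    continuous_const.sub ((continuous_const.matrix_mul continuous_id).matrix_mul continuous_const)
  rw [h]
  exact continuous_finsetSum _ fun i _ => continuous_finsetSum _ fun j _ =>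
    (hm.matrix_elem i j).pow 2

theorem exists_isMomentSolution {X Y : ℕ} (B : Matrix (Fin X) (Fin Y) ℝ) {K : Set (Fin X → ℝ)}
    (hK : IsClosed K) (hne : (momentFeasibleSet K).Nonempty) (M : Matrix (Fin Y) (Fin Y) ℝ) :
    ∃ A, IsMomentSolution B K M A :=
  (isCompact_momentFeasibleSet hK).exists_isMinOn hne (continuous_momentCost B M).continuousOn

/-- The parallelogram identity: the gain at the midpoint is strict unless both matrices have the
same image under `A ↦ Bᵀ * A * B`. -/
theorem momentCost_midpoint {X Y : ℕ} (B : Matrix (Fin X) (Fin Y) ℝ)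
    (M : Matrix (Fin Y) (Fin Y) ℝ) (A A' : Matrix (Fin X) (Fin X) ℝ) :
    momentCost B M ((1 / 2 : ℝ) • A + (1 / 2 : ℝ) • A') =
      (momentCost B M A + momentCost B M A') / 2 -
        (∑ i, ∑ j, ((Bᵀ * A * B) i j - (Bᵀ * A' * B) i j) ^ 2) / 4 := by
  simp only [momentCost_eq_sum, Matrix.mul_add, Matrix.add_mul, Matrix.mul_smul, Matrix.smul_mul,
    Matrix.sub_apply, Matrix.add_apply, Matrix.smul_apply, smul_eq_mul]
  rw [← Finset.sum_add_distrib, Finset.sum_div, Finset.sum_div, ← Finset.sum_sub_distrib]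
  refine Finset.sum_congr rfl fun i _ => ?_
  rw [← Finset.sum_add_distrib, Finset.sum_div, Finset.sum_div, ← Finset.sum_sub_distrib]
  exact Finset.sum_congr rfl fun j _ => by ring

theorem IsMomentSolution.eq {X Y : ℕ} {B : Matrix (Fin X) (Fin Y) ℝ} (hB : B.rank = X)
    {K : Set (Fin X → ℝ)} (hK : Convex ℝ K) {M : Matrix (Fin Y) (Fin Y) ℝ}
    {A A' : Matrix (Fin X) (Fin X) ℝ} (hA : IsMomentSolution B K M A)
    (hA' : IsMomentSolution B K M A') : A = A' := by
  have hmid : (1 / 2 : ℝ) • A + (1 / 2 : ℝ) • A' ∈ momentFeasibleSet K :=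
    convex_momentFeasibleSet hK hA.1 hA'.1 (by norm_num) (by norm_num) (by norm_num)
  have h1 := isMinOn_iff.1 hA.2 _ hmid
  have h2 := isMinOn_iff.1 hA'.2 _ hmid
  rw [momentCost_midpoint] at h1 h2
  have hnn : ∀ i, 0 ≤ ∑ j, ((Bᵀ * A * B) i j - (Bᵀ * A' * B) i j) ^ 2 := fun i =>
    Finset.sum_nonneg fun j _ => sq_nonneg _
  have h0 : ∑ i, ∑ j, ((Bᵀ * A * B) i j - (Bᵀ * A' * B) i j) ^ 2 = 0 :=
    le_antisymm (by linarith) (Finset.sum_nonneg fun i _ => hnn i)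
  have hL : Bᵀ * A * B = Bᵀ * A' * B := by
    ext i j
    have hi := (Finset.sum_eq_zero_iff_of_nonneg fun i _ => hnn i).1 h0 i (Finset.mem_univ i)
    have hj := (Finset.sum_eq_zero_iff_of_nonneg fun j _ => sq_nonneg _).1 hi j (Finset.mem_univ j)
    exact sub_eq_zero.1 (pow_eq_zero_iff two_ne_zero |>.1 hj)
  obtain ⟨C, hC⟩ := Matrix.exists_right_inverse_of_rank_eq hB
  rw [← eq_transpose_mul_mul_of_right_inverse hC A, hL, eq_transpose_mul_mul_of_right_inverse hC]

/-! ### Stability of solutions and recovery of the parameters -/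

/-- Solutions of the moment matching problem converge to `A` when the moments converge to the
moments `Bᵀ A B` of a feasible `A`. -/
theorem tendsto_isMomentSolution {X Y : ℕ} {B : Matrix (Fin X) (Fin Y) ℝ} (hB : B.rank = X)
    {K : Set (Fin X → ℝ)} {A : Matrix (Fin X) (Fin X) ℝ} (hA : A ∈ momentFeasibleSet K)
    {M : ℕ → Matrix (Fin Y) (Fin Y) ℝ} (hM : Tendsto M atTop (𝓝 (Bᵀ * A * B)))
    {Ahat : ℕ → Matrix (Fin X) (Fin X) ℝ}
    (hAhat : ∀ N ≥ 1, IsMomentSolution B K (M N) (Ahat N)) : Tendsto Ahat atTop (𝓝 A) := by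
  have hcost : Tendsto (fun N => momentCost B (M N) A) atTop (𝓝 0) := by
    have hc : Continuous fun M : Matrix (Fin Y) (Fin Y) ℝ =>
        ∑ i, ∑ j, ((M - Bᵀ * A * B) i j) ^ 2 :=
      continuous_finsetSum _ fun i _ => continuous_finsetSum _ fun j _ =>
        ((continuous_id.sub continuous_const).matrix_elem i j).pow 2
    have := (hc.tendsto _).comp hM
    simpa [Function.comp_def, momentCost_eq_sum] using this
  have hcost' : Tendsto (fun N => momentCost B (M N) (Ahat N)) atTop (𝓝 0) := by
    refine tendsto_of_tendsto_of_tendsto_of_le_of_le' tendsto_const_nhds hcost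
      (Eventually.of_forall fun N => by unfold momentCost; exact sq_nonneg _) ?_
    filter_upwards [eventually_ge_atTop 1] with N hN
    exact isMinOn_iff.1 (hAhat N hN).2 _ hA
  have hdiff : Tendsto (fun N => M N - Bᵀ * Ahat N * B) atTop (𝓝 0) := by
    refine tendsto_pi_nhds.2 fun i => tendsto_pi_nhds.2 fun j => ?_
    have h := hcost'.sqrt
    rw [Real.sqrt_zero] at h
    refine squeeze_zero_norm (fun N => ?_) h
    rw [Real.norm_eq_abs, ← Real.sqrt_sq_eq_abs]
    refine Real.sqrt_le_sqrt ?_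
    rw [momentCost_eq_sum]
    exact (Finset.single_le_sum (f := fun j => ((M N - Bᵀ * Ahat N * B) i j) ^ 2)
      (fun j _ => sq_nonneg _) (Finset.mem_univ j)).trans
      (Finset.single_le_sum (f := fun i => ∑ j, ((M N - Bᵀ * Ahat N * B) i j) ^ 2)
        (fun i _ => Finset.sum_nonneg fun j _ => sq_nonneg _) (Finset.mem_univ i))
  have hL : Tendsto (fun N => Bᵀ * Ahat N * B) atTop (𝓝 (Bᵀ * A * B)) := by
    simpa using hM.sub hdiff
  obtain ⟨C, hC⟩ := Matrix.exists_right_inverse_of_rank_eq hB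
  have hinv : Continuous fun L : Matrix (Fin Y) (Fin Y) ℝ => Cᵀ * L * C :=
    (continuous_const.matrix_mul continuous_id).matrix_mul continuous_const
  have := (hinv.tendsto _).comp hL
  simpa only [Function.comp_def, eq_transpose_mul_mul_of_right_inverse hC] using this

/-- All row sums must be nonzero, not just the one of row `i`: the inverse of a singular diagonal
matrix is zero by convention. -/
theorem recoverTransition_apply {X : ℕ} (A : Matrix (Fin X) (Fin X) ℝ) (i j : Fin X)
    (h : ∀ i, (A *ᵥ 1) i ≠ 0) : recoverTransition A i j = ((A *ᵥ 1) i)⁻¹ * A i j := by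
  have hinv : (Matrix.diagonal (A *ᵥ 1))⁻¹ = Matrix.diagonal fun i => ((A *ᵥ 1) i)⁻¹ := by
    refine Matrix.inv_eq_right_inv ?_
    rw [Matrix.diagonal_mul_diagonal, ← Matrix.diagonal_one]
    exact congrArg _ (funext fun i => mul_inv_cancel₀ (h i))
  rw [recoverTransition, hinv, Matrix.diagonal_mul]

theorem tendsto_recoverStationary {X : ℕ} {A : Matrix (Fin X) (Fin X) ℝ}
    {Ahat : ℕ → Matrix (Fin X) (Fin X) ℝ} (h : Tendsto Ahat atTop (𝓝 A)) :
    Tendsto (fun N => recoverStationary (Ahat N)) atTop (𝓝 (recoverStationary A)) :=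
  ((continuous_id.matrix_mulVec continuous_const).tendsto A).comp h

theorem tendsto_recoverTransition {X : ℕ} {A : Matrix (Fin X) (Fin X) ℝ}
    {Ahat : ℕ → Matrix (Fin X) (Fin X) ℝ} (h : Tendsto Ahat atTop (𝓝 A))
    (hpos : ∀ i, (A *ᵥ 1) i ≠ 0) (hpos' : ∀ N ≥ 1, ∀ i, (Ahat N *ᵥ 1) i ≠ 0) :
    Tendsto (fun N => recoverTransition (Ahat N)) atTop (𝓝 (recoverTransition A)) := by
  refine tendsto_pi_nhds.2 fun i => tendsto_pi_nhds.2 fun j => ?_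
  rw [recoverTransition_apply A i j hpos]
  have h1 := tendsto_pi_nhds.1 (tendsto_recoverStationary h) i
  have h2 := tendsto_pi_nhds.1 (tendsto_pi_nhds.1 h i) j
  refine ((h1.inv₀ (hpos i)).mul h2).congr' ?_
  filter_upwards [eventually_ge_atTop 1] with N hN
  exact (recoverTransition_apply (Ahat N) i j (hpos' N hN)).symm

theorem diagonal_mul_mulVec_one {X : ℕ} {P : Matrix (Fin X) (Fin X) ℝ}
    (hP : P ∈ Matrix.rowStochastic ℝ (Fin X)) (p : Fin X → ℝ) :
    (Matrix.diagonal p * P) *ᵥ 1 = p := by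
  rw [← Matrix.mulVec_mulVec, (Matrix.mem_rowStochastic.1 hP).2]
  ext i
  simp [Matrix.mulVec_diagonal]

/-- Row sums of this joint law are `p` by stochasticity of `P`, column sums are `p` by stationarity.
-/
theorem diagonal_mul_mem_momentFeasibleSet {X : ℕ} {P : Matrix (Fin X) (Fin X) ℝ}
    (hP : P ∈ Matrix.rowStochastic ℝ (Fin X)) {p : Fin X → ℝ}
    (hp : IsStationaryDistribution P p) {K : Set (Fin X → ℝ)} (hpK : p ∈ K) :
    Matrix.diagonal p * P ∈ momentFeasibleSet K := by
  have h1 := diagonal_mul_mulVec_one hP p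
  refine ⟨fun i j => ?_, ?_, ?_, ?_⟩
  · rw [Matrix.diagonal_mul]
    exact mul_nonneg (hp.1.1 i) ((Matrix.mem_rowStochastic.1 hP).1 i j)
  · rw [h1, one_dotProduct]
    exact hp.1.2
  · rwa [h1]
  · rw [h1, Matrix.transpose_mul, Matrix.diagonal_transpose, ← Matrix.mulVec_mulVec]
    have : Matrix.diagonal p *ᵥ (1 : Fin X → ℝ) = p := by
      ext i
      simp [Matrix.mulVec_diagonal]
    rw [this]
    exact hp.2

theorem recoverTransition_diagonal_mul {X : ℕ} {P : Matrix (Fin X) (Fin X) ℝ}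
    (hP : P ∈ Matrix.rowStochastic ℝ (Fin X)) {p : Fin X → ℝ} (hp : ∀ i, p i ≠ 0) :
    recoverTransition (Matrix.diagonal p * P) = P := by
  have h1 := diagonal_mul_mulVec_one hP p
  ext i j
  rw [recoverTransition_apply _ i j (by rwa [h1]), h1, Matrix.diagonal_mul,
    inv_mul_cancel_left₀ (hp i)]

/-! ### The hidden Markov model as a Markov chain of pairs -/

section HiddenMarkov

variable {Ω : Type*} [MeasurableSpace Ω] {μ : Measure Ω} {X Y : ℕ} {p₀ : Fin X → ℝ}
  {P : Matrix (Fin X) (Fin X) ℝ} {B : Matrix (Fin X) (Fin Y) ℝ}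
  {x : ℕ → Ω → Fin X} {y : ℕ → Ω → Fin Y}

/-- The pairs of states and observations of a hidden Markov model form a Markov chain. -/
theorem IsHMM.real_transition (hmm : IsHMM μ p₀ P B x y) (hp₀ : ∀ i, 0 ≤ p₀ i)
    (hP : ∀ i j, 0 ≤ P i j) (hB : ∀ i j, 0 ≤ B i j) (n : ℕ) (a : ℕ → Fin X × Fin Y)
    (t : Fin X × Fin Y) :
    μ.real {ω | (∀ k ≤ n, (x k ω, y k ω) = a k) ∧ (x (n + 1) ω, y (n + 1) ω) = t} =
      (P (a n).1 t.1 * B t.1 t.2) * μ.real {ω | ∀ k ≤ n, (x k ω, y k ω) = a k} := by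
  have hlaw : ∀ (m : ℕ) (c : ℕ → Fin X × Fin Y),
      μ.real {ω | ∀ k ≤ m, (x k ω, y k ω) = c k} = p₀ (c 0).1 * B (c 0).1 (c 0).2 *
        ∏ k ∈ Finset.range m, (P (c k).1 (c (k + 1)).1 * B (c (k + 1)).1 (c (k + 1)).2) :=
    fun m c => by
      have h := hmm.joint_law m (fun k => (c k).1) (fun k => (c k).2)
      simp only [Prod.ext_iff]
      rw [measureReal_def, h, ENNReal.toReal_ofReal]
      exact mul_nonneg (mul_nonneg (hp₀ _) (hB _ _))
        (Finset.prod_nonneg fun k _ => mul_nonneg (hP _ _) (hB _ _))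
  -- Appending `t` to the path turns the joint event into a cylinder of length one more.
  set c : ℕ → Fin X × Fin Y := fun k => if k ≤ n then a k else t with hc
  have hca : ∀ k ≤ n, c k = a k := fun k hk => if_pos hk
  have hct : c (n + 1) = t := if_neg (by omega)
  have hset : {ω | (∀ k ≤ n, (x k ω, y k ω) = a k) ∧ (x (n + 1) ω, y (n + 1) ω) = t} =
      {ω | ∀ k ≤ n + 1, (x k ω, y k ω) = c k} := by
    ext ω
    simp only [Set.mem_ofPred_eq]
    constructor
    · rintro ⟨h1, h2⟩ k hk
      rcases Nat.le_succ_iff.1 hk with h | rfl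
      · rw [hca k h, h1 k h]
      · rw [hct, h2]
    · intro h
      exact ⟨fun k hk => (h k (by omega)).trans (hca k hk), (h (n + 1) le_rfl).trans hct⟩
  have hset' : {ω | ∀ k ≤ n, (x k ω, y k ω) = a k} = {ω | ∀ k ≤ n, (x k ω, y k ω) = c k} := by
    ext ω
    exact forall₂_congr fun k hk => by rw [hca k hk]
  rw [hset, hset', hlaw, hlaw, Finset.prod_range_succ, hca n le_rfl, hct]
  ring

/-- The empirical second-order moments of a positive hidden Markov model converge almost surely. -/
theorem IsHMM.ae_tendsto_empiricalMoments [IsProbabilityMeasure μ] (hmm : IsHMM μ p₀ P B x y)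
    (hp₀ : ∀ i, 0 ≤ p₀ i) (hP : P ∈ Matrix.rowStochastic ℝ (Fin X)) (hPpos : ∀ i j, 0 < P i j)
    (hBsum : ∀ i, ∑ j, B i j = 1) (hBpos : ∀ i j, 0 < B i j) {p : Fin X → ℝ}
    (hp : IsStationaryDistribution P p) :
    ∀ᵐ ω ∂μ, Tendsto (empiricalMoments fun k => y k ω) atTop
      (𝓝 (Bᵀ * (Matrix.diagonal p * P) * B)) := by
  have hPsum : ∀ i, ∑ j, P i j = 1 := fun i => by
    simpa [Matrix.mulVec, dotProduct] using congrFun (Matrix.mem_rowStochastic.1 hP).2 i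
  -- The pair chain draws a new state from `P`, then its observation from `B`; its stationary law is
  -- `p i * B i j`.
  have hmain := ae_tendsto_transition_average μ (S := Fin X × Fin Y)
    (Q := fun s t => P s.1 t.1 * B t.1 t.2) (w := fun k ω => (x k ω, y k ω))
    (q := fun s => p s.1 * B s.1 s.2) (fun s t => mul_pos (hPpos _ _) (hBpos _ _))
    (fun s => by simp [Fintype.sum_prod_type, ← Finset.mul_sum, hBsum, hPsum])
    (by simp [Fintype.sum_prod_type, ← Finset.mul_sum, hBsum, hp.1.2])
    (fun t => by
      have ht : ∑ i, p i * P i t.1 = p t.1 := by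
        conv_rhs => rw [hp.2]
        simp [Matrix.mulVec, dotProduct, mul_comm]
      calc ∑ s : Fin X × Fin Y, p s.1 * B s.1 s.2 * (P s.1 t.1 * B t.1 t.2)
          = ∑ i, ∑ j, p i * P i t.1 * B t.1 t.2 * B i j := by
            rw [Fintype.sum_prod_type]
            exact Finset.sum_congr rfl fun i _ => Finset.sum_congr rfl fun j _ => by ring
        _ = p t.1 * B t.1 t.2 := by
            simp only [← Finset.mul_sum, hBsum, mul_one]
            rw [← Finset.sum_mul, ht])
    (fun k => (hmm.measurable_state k).prodMk (hmm.measurable_obs k))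
    (fun n a t => hmm.real_transition hp₀ (fun i j => (hPpos i j).le) (fun i j => (hBpos i j).le)
      n a t)
  filter_upwards [hmain] with ω hω
  refine tendsto_pi_nhds.2 fun i => tendsto_pi_nhds.2 fun j => ?_
  -- Summing out the hidden states `a`, `b` turns pair transitions into transitions of observations.
  have h := tendsto_finsetSum Finset.univ fun a (_ : a ∈ Finset.univ) =>
    tendsto_finsetSum Finset.univ fun b (_ : b ∈ Finset.univ) => hω (a, i) (b, j)
  have hlim : ∑ a, ∑ b, p a * B a i * (P a b * B b j) =
      (Bᵀ * (Matrix.diagonal p * P) * B) i j := by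
    rw [Matrix.mul_apply, Finset.sum_comm]
    simp only [Matrix.mul_apply (M := Bᵀ), Matrix.diagonal_mul, Matrix.transpose_apply, Finset.sum_mul]
    exact Finset.sum_congr rfl fun b _ => Finset.sum_congr rfl fun a _ => by ring
  simp only at h
  rw [hlim] at h
  refine h.congr fun N => ?_
  simp only [empiricalMoments, Matrix.of_apply, one_div_mul_eq_div, ← Finset.sum_div]
  congr 1
  rw [Finset.sum_congr rfl fun a _ => Finset.sum_comm, Finset.sum_comm]
  refine Finset.sum_congr rfl fun k _ => ?_
  by_cases h1 : y k ω = i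
  · by_cases h2 : y (k + 1) ω = j
    · simp [h1, h2, ite_and]
    · simp [h2]
  · simp [h1]

end HiddenMarkov

/-! ### Unique solvability and strong consistency -/

theorem mainTheorem2 {Ω : Type*} [MeasurableSpace Ω] (μ : Measure Ω) [IsProbabilityMeasure μ]
    (X Y : ℕ) (p₀ : Fin X → ℝ) (hp₀ : p₀ ∈ stdSimplex ℝ (Fin X))
    (P : Matrix (Fin X) (Fin X) ℝ) (hP : P ∈ Matrix.rowStochastic ℝ (Fin X))
    (hPpos : ∀ i j, 0 < P i j)
    (B : Matrix (Fin X) (Fin Y) ℝ) (hBsum : ∀ i, ∑ j, B i j = 1)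
    (hBpos : ∀ i j, 0 < B i j) (hBrank : B.rank = X)
    (x : ℕ → Ω → Fin X) (y : ℕ → Ω → Fin Y) (hmm : IsHMM μ p₀ P B x y)
    (pinf : Fin X → ℝ) (hpinf : IsStationaryDistribution P pinf)
    (K : Set (Fin X → ℝ)) (hK : IsPolyhedron K) (hKpos : ∀ v ∈ K, ∀ i, 0 < v i)
    (hpinfK : pinf ∈ K) :
    (∀ M : Matrix (Fin Y) (Fin Y) ℝ, ∃! A, IsMomentSolution B K M A) ∧
    ∀ᵐ ω ∂μ, ∀ Ahat : ℕ → Matrix (Fin X) (Fin X) ℝ,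
      (∀ N ≥ 1, IsMomentSolution B K (empiricalMoments (fun k => y k ω) N) (Ahat N)) →
        Tendsto (fun N => recoverTransition (Ahat N)) atTop (𝓝 P) ∧
        Tendsto (fun N => recoverStationary (Ahat N)) atTop (𝓝 pinf) := by
  have hfeas := diagonal_mul_mem_momentFeasibleSet hP hpinf hpinfK
  have hpos : ∀ i, pinf i ≠ 0 := fun i => (hKpos pinf hpinfK i).ne'
  have hone := diagonal_mul_mulVec_one hP pinf
  refine ⟨fun M => ?_, ?_⟩
  · obtain ⟨A, hA⟩ := exists_isMomentSolution B hK.isClosed ⟨_, hfeas⟩ M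
    exact ⟨A, hA, fun A' hA' => hA'.eq hBrank hK.convex hA⟩
  · filter_upwards [hmm.ae_tendsto_empiricalMoments hp₀.1 hP hPpos hBsum hBpos hpinf]
      with ω hω Ahat hAhat
    have hlim := tendsto_isMomentSolution hBrank hfeas hω hAhat
    constructor
    -- Feasibility puts the row sums of every estimate with `N ≥ 1` in `K`, so none of them
    -- vanishes.
    · have h := tendsto_recoverTransition hlim (by rwa [hone])
        fun N hN i => (hKpos _ (hAhat N hN).1.2.2.1 i).ne'
      rwa [recoverTransition_diagonal_mul hP hpos] at h
    · have h := tendsto_recoverStationary hlim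
      rwa [recoverStationary, hone] at h
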